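/- Let $\lambda>0$, $\mu>0$ and $\rho=\lambda/\mu$, and let $(F_N)_{N\ge 1}$ be non-negative integers with $\lim_{N\to+\infty}F_N/N=\beta$. For $N\ge 1$, let $(X^N(t))_{t\ge 0}=(X_0^N(t),X_1^N(t))_{t\ge 0}$ be a càdlàg Markov process on the finite state space ${\cal S}_N=\{(x_0,x_1)\in\mathbb N^2: x_0+x_1\le F_N\}$ whose $Q$-matrix is given by the transition rates $$ (x_0,x_1)\to\begin{cases}(x_0,x_1+1)&\text{at rate } 2\mu(F_N-x_0-x_1),\\ (x_0,x_1-1)&\text{at rate } \lambda N\,\mathbf 1_{\{x_1>0\}},\\ (x_0+1,x_1-1)&\text{at rate } \mu x_1.\end{cases} $$ ($X_0^N(t)$ is the number of lost files and $X_1^N(t)$ the number of files with exactly one copy at time $t$, when there are $F_N$ files in total.) Assume that the initial state $(X_0^N(0),X_1^N(0))$ is a fixed pair $y\in\mathbb N^2$, not depending on $N$, which belongs to ${\cal S}_N$ for all $N\ge 1$. Then, as $N\to+\infty$, the sequence of processes $$ \left(\frac{X_0^N(t)}{N},\frac{X_1^N(t)}{N}\right)_{t\ge 0} $$ converges in distribution,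 in the space ${\cal D}(\mathbb R_+,\mathbb R^2)$ of càdlàg functions with the Skorokhod topology, to the deterministic function $$ t\mapsto\begin{cases}\left(\left(\beta-\frac{\rho}{2}\right)\left(1-2e^{-\mu t}+e^{-2\mu t}\right),\ (2\beta-\rho)\left(e^{-\mu t}-e^{-2\mu t}\right)\right)&\text{if }\rho\le 2\beta,\\ (0,0)&\text{if }\rho>2\beta.\end{cases} $$ -/

import Mathlib

open Filter Topology MeasureTheory ProbabilityTheory Set
open scoped NNReal ENNReal

noncomputable section

namespace StorageNetwork

/-! ### Càdlàg functions and the Skorokhod topology -/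

/-- `x : [0, ∞) → E` is right-continuous with left limits. -/
def IsCadlag {E : Type*} [TopologicalSpace E] (x : ℝ≥0 → E) : Prop :=
  ∀ t, ContinuousWithinAt x (Ici t) t ∧ ∃ l, Tendsto x (𝓝[<] t) (𝓝 l)

theorem IsCadlag.comp {E G : Type*} [TopologicalSpace E] [TopologicalSpace G] {x : ℝ≥0 → E}
    (hx : IsCadlag x) {g : E → G} (hg : Continuous g) : IsCadlag (fun t => g (x t)) := by
  intro t
  obtain ⟨hr, l, hl⟩ := hx t
  exact ⟨hg.continuousAt.comp_continuousWithinAt hr, g l, (hg.tendsto l).comp hl⟩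

theorem IsCadlag.of_continuous {E : Type*} [TopologicalSpace E] {x : ℝ≥0 → E}
    (hx : Continuous x) : IsCadlag x :=
  fun t => ⟨hx.continuousWithinAt, x t, hx.continuousAt.tendsto.mono_left nhdsWithin_le_nhds⟩

/-- The space `D([0, ∞), E)` of càdlàg functions. -/
def SkorokhodSpace (E : Type*) [TopologicalSpace E] : Type _ :=
  {x : ℝ≥0 → E // IsCadlag x}

/-- `y` is `ε`-close to `x` on `[0, T]` after a time change `θ` (an increasing bijection of
`[0, ∞)`) which is uniformly `ε`-close to the identity. -/
def SkorokhodClose {E : Type*} [PseudoMetricSpace E] (ε : ℝ) (T : ℝ≥0)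
    (x y : SkorokhodSpace E) : Prop :=
  ∃ θ : ℝ≥0 ≃o ℝ≥0, (∀ t, dist (θ t) t ≤ ε) ∧ ∀ t ≤ T, dist (y.1 (θ t)) (x.1 t) ≤ ε

theorem SkorokhodClose.mono {E : Type*} [PseudoMetricSpace E] {ε ε' : ℝ} {T T' : ℝ≥0}
    {x y : SkorokhodSpace E} (h : SkorokhodClose ε T x y) (hε : ε ≤ ε') (hT : T' ≤ T) :
    SkorokhodClose ε' T' x y := by
  obtain ⟨θ, h1, h2⟩ := h
  exact ⟨θ, fun t => (h1 t).trans hε, fun t ht => (h2 t (ht.trans hT)).trans hε⟩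

/-- The Skorokhod (J1) topology on `D([0, ∞), E)`: the neighbourhoods of `x` are the sets
containing all `y` with `SkorokhodClose ε T x y`, for some `ε > 0` and `T`. So `xₙ → x` iff there
are time changes `θₙ` with `sup_t |θₙ(t) - t| → 0` and `sup_{t ≤ T} dist (xₙ(θₙ(t))) (x t) → 0`
for all `T`. -/
instance {E : Type*} [PseudoMetricSpace E] : TopologicalSpace (SkorokhodSpace E) where
  IsOpen U := ∀ x ∈ U, ∃ ε > 0, ∃ T, ∀ y, SkorokhodClose ε T x y → y ∈ U
  isOpen_univ := fun _ _ => ⟨1, one_pos, 0, fun _ _ => mem_univ _⟩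
  isOpen_inter := by
    rintro U V hU hV x ⟨hxU, hxV⟩
    obtain ⟨ε, hε, T, h⟩ := hU x hxU
    obtain ⟨ε', hε', T', h'⟩ := hV x hxV
    exact ⟨min ε ε', lt_min hε hε', max T T', fun y hy =>
      ⟨h y (hy.mono (min_le_left _ _) (le_max_left _ _)),
        h' y (hy.mono (min_le_right _ _) (le_max_right _ _))⟩⟩
  isOpen_sUnion := by
    rintro S hS x ⟨U, hU, hxU⟩
    obtain ⟨ε, hε, T, h⟩ := hS U hU x hxU
    exact ⟨ε, hε, T, fun y hy => ⟨U, hU, h y hy⟩⟩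

instance {E : Type*} [PseudoMetricSpace E] : MeasurableSpace (SkorokhodSpace E) := borel _

instance {E : Type*} [PseudoMetricSpace E] : BorelSpace (SkorokhodSpace E) := ⟨rfl⟩

/-! ### The Markov process -/

/-- The state space: pairs `(x₀, x₁)` with `x₀ + x₁ ≤ F`, where `x₀` is the number of lost files,
`x₁` the number of files with exactly one copy, and `F` the total number of files. -/
abbrev State (F : ℕ) : Type := {x : ℕ × ℕ // x.1 + x.2 ≤ F}

instance (F : ℕ) : Fintype (State F) :=
  Fintype.ofInjective
    (fun x : State F => ((⟨x.1.1, by have := x.2; omega⟩, ⟨x.1.2, by have := x.2; omega⟩) :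
      Fin (F + 1) × Fin (F + 1)))
    (by
      intro x y h
      simp only [Prod.mk.injEq, Fin.mk.injEq] at h
      exact Subtype.ext (Prod.ext h.1 h.2))

/-- The rate of the jump from `x` to `y`:
`(x₀, x₁) → (x₀, x₁ + 1)` at rate `2 μ (F - x₀ - x₁)` (a file with two copies loses one of them),
`(x₀, x₁) → (x₀, x₁ - 1)` at rate `λ N` if `x₁ > 0` (a file with one copy is duplicated),
`(x₀, x₁) → (x₀ + 1, x₁ - 1)` at rate `μ x₁` (a file with one copy is lost). -/
def jumpRate (lam mu : ℝ) (N F : ℕ) (x y : ℕ × ℕ) : ℝ :=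
  if y.1 = x.1 ∧ y.2 = x.2 + 1 then 2 * mu * ((F : ℝ) - x.1 - x.2)
  else if y.1 = x.1 ∧ y.2 + 1 = x.2 then lam * N
  else if y.1 = x.1 + 1 ∧ y.2 + 1 = x.2 then mu * x.2
  else 0

/-- The `Q`-matrix of the process: jump rates off the diagonal, rows summing to zero. -/
def qMatrix (lam mu : ℝ) (N F : ℕ) : Matrix (State F) (State F) ℝ :=
  Matrix.of fun x y =>
    if x = y then -∑ z ∈ Finset.univ.erase x, jumpRate lam mu N F x.1 z.1
    else jumpRate lam mu N F x.1 y.1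

/-- `X` is a càdlàg Markov process with respect to the filtration `ℱ` on the finite state space `S`,
with `Q`-matrix `Q`, that is, with transition matrices `exp (h Q)`, `h ≥ 0`. -/
structure IsMarkovJumpProcess {S Ω : Type*} [Fintype S] [DecidableEq S] [TopologicalSpace S]
    [MeasurableSpace S] {m : MeasurableSpace Ω} (P : Measure Ω) (ℱ : Filtration ℝ≥0 m)
    (Q : Matrix S S ℝ) (X : ℝ≥0 → Ω → S) : Prop where
  cadlag : ∀ ω, IsCadlag (fun t => X t ω)
  adapted : ∀ t, Measurable[ℱ t] (X t)
  markov : ∀ (s h : ℝ≥0) (j : S),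
    P[fun ω => if X (s + h) ω = j then (1 : ℝ) else 0 | ℱ s]
      =ᵐ[P] fun ω => NormedSpace.exp ((h : ℝ) • Q) (X s ω) j

/-- The path `t ↦ (x₀(t) / N, x₁(t) / N)`, as an element of `D([0, ∞), ℝ²)`. -/
def scaledPath (N : ℕ) {F : ℕ} (x : ℝ≥0 → State F) (hx : IsCadlag x) : SkorokhodSpace (ℝ × ℝ) :=
  ⟨fun t => (((x t).1.1 : ℝ) / N, ((x t).1.2 : ℝ) / N),
    hx.comp (g := fun z : State F => ((z.1.1 : ℝ) / N, (z.1.2 : ℝ) / N))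
      continuous_of_discreteTopology⟩

/-- The limiting path, with `ρ = λ / μ`. -/
def fluidLimit (rho mu β : ℝ) : SkorokhodSpace (ℝ × ℝ) :=
  ⟨fun t : ℝ≥0 =>
    if rho ≤ 2 * β then
      ((β - rho / 2) * (1 - 2 * Real.exp (-mu * t) + Real.exp (-2 * mu * t)),
        (2 * β - rho) * (Real.exp (-mu * t) - Real.exp (-2 * mu * t)))
    else (0, 0),
    IsCadlag.of_continuous (by split_ifs <;> fun_prop)⟩

end StorageNetwork

end

open StorageNetwork

namespace StorageNetwork

/-! The limit `(p, q)` solves an ODE in which the discontinuous service rate `lam * 1_{x₁ > 0}` is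
replaced by `lam * h`, where `0 ≤ h ≤ 1` and `q (1 - h) = 0`. The squared distance from `X / N` to
`(p, q)` serves as Lyapunov function. Complementarity gives the reflection term a favourable sign,
so no averaging or reflection map is needed, and the squared distance grows at rate at most `mu`
times itself plus an error tending to `0` (`qMatrix_mulVec_sqDist_le`). Discounting by `exp (-mu t)`
and adding a linear compensator gives a nonnegative supermartingale. The maximal inequality
`measure_exists_lt_le` then yields uniform closeness on compact intervals, with probability tending
to `1` (`measure_exists_lt_sqDist_le`).

Two facts about the Skorokhod topology turn this into convergence in distribution: the random path
is Borel measurable (`measurable_image`, by step-path approximation), and closeness in probability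
to a fixed path implies weak convergence to its Dirac mass
(`tendstoInDistribution_of_measure_not_skorokhodClose`). -/

/-! ### Composition and inversion of time changes. -/

theorem SkorokhodClose.trans {E : Type*} [PseudoMetricSpace E] {ε ε' : ℝ} {T T' : ℝ≥0}
    {x y z : SkorokhodSpace E} (h : SkorokhodClose ε T x y) (h' : SkorokhodClose ε' T' y z)
    (hT : (T : ℝ) + ε ≤ T') : SkorokhodClose (ε + ε') T x z := by
  obtain ⟨θ, h1, h2⟩ := h
  obtain ⟨θ', h1', h2'⟩ := h'
  refine ⟨θ.trans θ', fun t => ?_, fun t ht => ?_⟩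
  · have := dist_triangle (θ' (θ t)) (θ t) t
    simp only [OrderIso.trans_apply]
    linarith [h1 t, h1' (θ t)]
  -- The first time change can push `t ≤ T` as far as `T + ε`, hence the larger window required of
  -- the second.
  · have hθ : θ t ≤ T' := by
      have h3 := h1 t
      rw [NNReal.dist_eq] at h3
      have h4 := (abs_le.1 h3).2
      have h5 : (t : ℝ) ≤ T := by exact_mod_cast ht
      rw [← NNReal.coe_le_coe]
      linarith
    have := dist_triangle (z.1 (θ' (θ t))) (y.1 (θ t)) (x.1 t)
    simp only [OrderIso.trans_apply]
    linarith [h2 t ht, h2' _ hθ]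

theorem SkorokhodClose.symm {E : Type*} [PseudoMetricSpace E] {ε : ℝ} {T T' : ℝ≥0}
    {x y : SkorokhodSpace E} (h : SkorokhodClose ε T x y) (hT : (T' : ℝ) + ε ≤ T) :
    SkorokhodClose ε T' y x := by
  obtain ⟨θ, h1, h2⟩ := h
  refine ⟨θ.symm, fun t => ?_, fun t ht => ?_⟩
  · have := h1 (θ.symm t)
    rwa [OrderIso.apply_symm_apply, dist_comm] at this
  · have h3 := h1 (θ.symm t)
    rw [OrderIso.apply_symm_apply, NNReal.dist_eq] at h3
    have h4 := (abs_le.1 h3).1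
    have h5 : (t : ℝ) ≤ T' := by exact_mod_cast ht
    have h6 : θ.symm t ≤ T := by
      rw [← NNReal.coe_le_coe]
      linarith
    have := h2 _ h6
    rwa [OrderIso.apply_symm_apply, dist_comm] at this

/-! ### Sampling of càdlàg functions with discrete values -/

section Discrete

variable {S : Type*} [TopologicalSpace S] [DiscreteTopology S] {x : ℝ≥0 → S}

/-- In a discrete space, a one-sided limit makes the path constant on a punctured one-sided
neighbourhood, which is open. -/
theorem IsCadlag.eventually_continuousAt (hx : IsCadlag x) (t : ℝ≥0) :
    ∀ᶠ s in 𝓝[≠] t, ContinuousAt x s := by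
  have key : ∀ {U : Set ℝ≥0} {a : S}, IsOpen U → (∀ᶠ s in 𝓝[U] t, x s = a) →
      ∀ᶠ s in 𝓝[U] t, ContinuousAt x s := by
    intro U a hU h
    filter_upwards [eventually_eventually_nhdsWithin.2 h, self_mem_nhdsWithin] with s hs hsU
    rw [hU.nhdsWithin_eq hsU] at hs
    have hsa : x s = a := hs.self_of_nhds
    refine (continuousAt_const (y := a)).congr ?_
    filter_upwards [hs] with r hr using hr.symm
  obtain ⟨hr, l, hl⟩ := hx t
  rw [← nhdsLT_sup_nhdsGT, eventually_sup]
  constructor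
  · refine key isOpen_Iio (a := l) ?_
    have := hl (show {l} ∈ 𝓝 l by simp)
    filter_upwards [this] with s hs using hs
  · refine key isOpen_Ioi (a := x t) ?_
    have := hr (show {x t} ∈ 𝓝 (x t) by simp)
    exact nhdsWithin_mono _ Ioi_subset_Ici_self this

theorem IsCadlag.finite_not_continuousAt (hx : IsCadlag x) (T : ℝ≥0) :
    {t | t ≤ T ∧ ¬ ContinuousAt x t}.Finite := by
  by_contra hinf
  obtain ⟨t, -, ht⟩ := Set.Infinite.exists_accPt_of_subset_isCompact (K := Icc 0 T) hinf
    isCompact_Icc (fun t ht => ⟨zero_le, ht.1⟩)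
  rw [accPt_iff_frequently_nhdsNE] at ht
  refine ht ?_
  filter_upwards [hx.eventually_continuousAt t] with s hs h
  exact h.2 hs

theorem IsCadlag.eq_of_continuousAt (hx : IsCadlag x) {u t : ℝ≥0} (hut : u ≤ t)
    (h : ∀ a ∈ Ioc u t, ContinuousAt x a) : x u = x t := by
  have hc : ContinuousOn x (Icc u t) := by
    intro a ha
    rcases ha.1.eq_or_lt with rfl | hlt
    · exact (hx u).1.mono Icc_subset_Ici_self
    · exact (h a ⟨hlt, ha.2⟩).continuousWithinAt
  exact isPreconnected_Icc.constant hc ⟨le_rfl, hut⟩ ⟨hut, le_rfl⟩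

/-- A Lipschitz function with small constant can be added to the identity to give a time change. -/
theorem exists_orderIso_add {g : ℝ≥0 → ℝ} (hg : LipschitzWith (1 / 2) g) (hg0 : g 0 = 0)
    (hpos : ∀ t, 0 ≤ g t) : ∃ θ : ℝ≥0 ≃o ℝ≥0, ∀ t, (θ t : ℝ) = t + g t := by
  set f : ℝ≥0 → ℝ≥0 := fun t => t + (g t).toNNReal with hf
  have hfc : ∀ t, (f t : ℝ) = t + g t := fun t => by simp [hf, hpos t]
  have hmono : StrictMono f := by
    intro s t hst
    have h1 := hg.dist_le_mul s t
    have hst' : (s : ℝ) < t := by exact_mod_cast hst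
    rw [Real.dist_eq, NNReal.dist_eq, abs_sub_comm (s : ℝ), abs_of_pos (sub_pos.2 hst')] at h1
    have h2 := (abs_le.1 h1).2
    push_cast at h2
    rw [← NNReal.coe_lt_coe, hfc, hfc]
    linarith
  have hcont : Continuous f := continuous_id.add (continuous_real_toNNReal.comp hg.continuous)
  have hsurj : Function.Surjective f := fun t =>
    mem_range_of_exists_le_of_exists_ge hcont ⟨0, by simp [hf, hg0]⟩ ⟨t, by simp [hf]⟩
  exact ⟨hmono.orderIsoOfSurjective f hsurj, hfc⟩

/-- The time change delays each of the finitely many jumps to the next grid point `k / n`. Rounding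
`θ t` down to the grid then crosses no jump, so the sample equals `x t` exactly. -/
theorem IsCadlag.eventually_exists_sampling (hx : IsCadlag x) (T : ℝ≥0) :
    ∀ᶠ n : ℕ in atTop, ∃ θ : ℝ≥0 ≃o ℝ≥0, (∀ t, dist (θ t) t ≤ 1 / n) ∧
      ∀ t ≤ T, x (⌊n * θ t⌋₊ / n) = x t := by
  -- Including `0` forces `θ 0 = 0`; the margin `1` covers the delay, at most `1 / n`.
  set J : Set ℝ≥0 := insert 0 {t | t ≤ T + 1 ∧ ¬ ContinuousAt x t} with hJ
  have hfin : J.Finite := (hx.finite_not_continuousAt (T + 1)).insert 0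
  obtain ⟨δ, hδ, hsep⟩ : ∃ δ : ℝ, 0 < δ ∧ ∀ a ∈ J, ∀ b ∈ J, a ≠ b → δ ≤ dist a b := by
    obtain ⟨δ, hδ0, hδ⟩ := ENNReal.lt_iff_exists_nnreal_btwn.1 hfin.einfsep_pos
    refine ⟨δ, by exact_mod_cast hδ0, fun a ha b hb hab => ?_⟩
    have := Set.le_edist_of_le_einfsep ha hb hab hδ.le
    rw [edist_nndist, ENNReal.coe_le_coe] at this
    exact_mod_cast this
  have hev : ∀ᶠ n : ℕ in atTop, (1 : ℝ) / n < δ / 2 :=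
    tendsto_one_div_atTop_nhds_zero_nat.eventually_lt_const (half_pos hδ)
  filter_upwards [hev, eventually_ge_atTop 1] with n hn hn1
  have hn0 : (0 : ℝ) < n := by exact_mod_cast hn1
  set c : ℝ≥0 → ℝ := fun a => (⌈(n : ℝ) * a⌉₊ : ℝ) / n - a with hc
  have hc0 : ∀ a, 0 ≤ c a := fun a => by
    rw [hc, sub_nonneg, le_div_iff₀ hn0, mul_comm]
    exact Nat.le_ceil _
  have hc1 : ∀ a, c a ≤ 1 / n := fun a => by
    have := (Nat.ceil_lt_add_one (show 0 ≤ (n : ℝ) * a by positivity)).le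
    have h2 : (⌈(n : ℝ) * a⌉₊ : ℝ) / n ≤ (n * a + 1) / n := by gcongr
    rw [add_div, mul_div_cancel_left₀ _ hn0.ne'] at h2
    simp only [hc]; linarith
  -- Delays differ by at most `1 / n < δ / 2`, while distinct points of `J` are at least `δ` apart.
  have hlip : LipschitzOnWith (1 / 2) c J := by
    refine LipschitzOnWith.of_dist_le_mul fun a ha b hb => ?_
    rcases eq_or_ne a b with rfl | hab
    · simp
    have h1 := hsep a ha b hb hab
    rw [Real.dist_eq]
    have h2 : |c a - c b| ≤ 1 / n := abs_le.2 ⟨by linarith [hc0 a, hc1 b], by linarith [hc0 b, hc1 a]⟩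
    push_cast
    linarith
  obtain ⟨g₀, hg₀, hg₀c⟩ := hlip.extend_real
  set g : ℝ≥0 → ℝ := fun t => max 0 (min (g₀ t) (1 / n)) with hg
  have hglip : LipschitzWith (1 / 2) g := (hg₀.min_const _).const_max _
  have hgJ : ∀ a ∈ J, g a = c a := fun a ha => by
    simp only [hg]
    rw [← hg₀c ha, min_eq_left (hc1 a), max_eq_right (hc0 a)]
  have hg1 : ∀ a, g a ≤ 1 / n := fun a => max_le (by positivity) (min_le_right _ _)
  have hg0 : ∀ a, 0 ≤ g a := fun a => le_max_left _ _
  obtain ⟨θ, hθ⟩ := exists_orderIso_add hglip (by rw [hgJ 0 (mem_insert _ _)]; simp [hc]) hg0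
  refine ⟨θ, fun t => ?_, fun t ht => ?_⟩
  · rw [NNReal.dist_eq, hθ, add_sub_cancel_left, abs_of_nonneg (hg0 t)]
    exact hg1 t
  have hnn : (0 : ℝ≥0) < n := by exact_mod_cast hn1
  have hθJ : ∀ a ∈ J, θ a = ⌈n * a⌉₊ / n := fun a ha => by
    apply NNReal.coe_injective
    rw [hθ, hgJ a ha]
    simp only [hc]
    push_cast
    rw [show ⌈(n : ℝ≥0) * a⌉₊ = ⌈(n : ℝ) * a⌉₊ by
      refine eq_of_forall_ge_iff fun k => ?_
      rw [Nat.ceil_le, Nat.ceil_le, ← NNReal.coe_le_coe]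
      push_cast
      rfl]
    ring
  -- Since `θ a` is a grid point not before `a`, rounding `θ t` down preserves its order relative to
  -- `θ a`. The proof uses `⌈n * a⌉₊ ≤ ⌊n * θ t⌋₊` as the common form of both sides.
  have hiff : ∀ a ∈ J, (a ≤ t ↔ a ≤ (⌊n * θ t⌋₊ : ℝ≥0) / n) := by
    intro a ha
    rw [← θ.le_iff_le, hθJ a ha, div_le_iff₀ hnn, le_div_iff₀ hnn, mul_comm (θ t), mul_comm a,
      ← Nat.le_floor_iff zero_le, Nat.ceil_le]
  have hθT : θ t ≤ T + 1 := by
    rw [← NNReal.coe_le_coe, hθ]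
    have h1 : (1 : ℝ) / n ≤ 1 := by
      rw [div_le_one hn0]; exact_mod_cast hn1
    have h2 : (t : ℝ) ≤ T := by exact_mod_cast ht
    push_cast
    linarith [hg1 t]
  have huT : (⌊n * θ t⌋₊ : ℝ≥0) / n ≤ T + 1 := by
    refine le_trans ?_ hθT
    rw [div_le_iff₀ hnn, mul_comm]
    exact Nat.floor_le zero_le
  have hJmem : ∀ a ≤ T + 1, a ∉ J → ContinuousAt x a := fun a ha haJ => by
    by_contra hcon
    exact haJ (mem_insert_of_mem _ ⟨ha, hcon⟩)
  rcases le_total ((⌊n * θ t⌋₊ : ℝ≥0) / n) t with hle | hle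
  · refine hx.eq_of_continuousAt hle fun a ha => hJmem a (ha.2.trans (ht.trans (by simp))) fun haJ => ?_
    exact absurd ((hiff a haJ).1 ha.2) ha.1.not_ge
  · refine (hx.eq_of_continuousAt hle fun a ha => hJmem a (ha.2.trans huT) fun haJ => ?_).symm
    exact absurd ((hiff a haJ).2 ha.2) ha.1.not_ge

end Discrete

/-! ### Step-path approximation and measurability of the path map. -/

theorem isCadlag_floor_mul {n : ℕ} (hn : 0 < n) : IsCadlag (fun t : ℝ≥0 => ⌊n * t⌋₊) := by
  intro t
  have hcont : Continuous fun s : ℝ≥0 => (n : ℝ≥0) * s := by fun_prop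
  have hnn : (0 : ℝ≥0) < n := by exact_mod_cast hn
  constructor
  · refine tendsto_nhds_of_eventually_eq ?_
    have h1 : ∀ᶠ s in 𝓝 t, (n : ℝ≥0) * s < ⌊(n : ℝ≥0) * t⌋₊ + 1 :=
      hcont.continuousAt.eventually_lt_const (Nat.lt_floor_add_one _)
    filter_upwards [h1.filter_mono nhdsWithin_le_nhds, self_mem_nhdsWithin] with s hs hst
    rw [Nat.floor_eq_iff zero_le]
    refine ⟨(Nat.floor_le zero_le).trans ?_, hs⟩
    gcongr
    exact hst
  -- The truncated value at `t = 0` is harmless: there are no times to the left.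
  · refine ⟨⌈(n : ℝ≥0) * t⌉₊ - 1, tendsto_nhds_of_eventually_eq ?_⟩
    rcases eq_or_ne t 0 with rfl | ht
    · filter_upwards [self_mem_nhdsWithin] with s hs
      exact absurd hs (by simp)
    obtain ⟨k, hk⟩ : ∃ k, ⌈(n : ℝ≥0) * t⌉₊ = k + 1 := by
      refine Nat.exists_eq_succ_of_ne_zero (Nat.ceil_pos.2 ?_).ne'
      exact mul_pos hnn (pos_iff_ne_zero.2 ht)
    have hkt : (k : ℝ≥0) < n * t := by
      rw [← Nat.lt_ceil]; omega
    have htk : (n : ℝ≥0) * t ≤ k + 1 := by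
      have := Nat.le_ceil ((n : ℝ≥0) * t)
      rw [hk] at this
      exact_mod_cast this
    have h1 : ∀ᶠ s in 𝓝 t, (k : ℝ≥0) < n * s := hcont.continuousAt.eventually_const_lt hkt
    filter_upwards [h1.filter_mono nhdsWithin_le_nhds, self_mem_nhdsWithin] with s hs hst
    rw [hk, Nat.add_sub_cancel, Nat.floor_eq_iff zero_le]
    refine ⟨hs.le, lt_of_lt_of_le ?_ htk⟩
    gcongr
    exact hst

/-- The step function with value `v k` on `[k / n, (k + 1) / n)` for `k < n ^ 2`, constant on
`[n, ∞)`. -/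
noncomputable def stepPath {E : Type*} [TopologicalSpace E] {n : ℕ} (hn : 0 < n)
    (v : Fin (n ^ 2 + 1) → E) : SkorokhodSpace E :=
  ⟨fun t => v ⟨min ⌊n * t⌋₊ (n ^ 2), by omega⟩,
    (isCadlag_floor_mul hn).comp (g := fun k => v ⟨min k (n ^ 2), by omega⟩)
      continuous_of_discreteTopology⟩

/-- The path `t ↦ g (x t)`. -/
def SkorokhodSpace.image {S E : Type*} [TopologicalSpace S] [TopologicalSpace E] (g : S → E)
    (hg : Continuous g) (x : ℝ≥0 → S) (hx : IsCadlag x) : SkorokhodSpace E :=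
  ⟨fun t => g (x t), hx.comp hg⟩

theorem eventually_skorokhodClose_stepPath {S E : Type*} [TopologicalSpace S] [DiscreteTopology S]
    [PseudoMetricSpace E] {g : S → E} (hg : Continuous g) {x : ℝ≥0 → S} (hx : IsCadlag x)
    {ε : ℝ} (hε : 0 < ε) (T : ℝ≥0) :
    ∀ᶠ n : ℕ in atTop, ∀ hn : 0 < n, SkorokhodClose ε T (SkorokhodSpace.image g hg x hx)
      (stepPath hn fun k => g (x (k / n))) := by
  have hev : ∀ᶠ n : ℕ in atTop, (1 : ℝ) / n < ε :=
    tendsto_one_div_atTop_nhds_zero_nat.eventually_lt_const hε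
  filter_upwards [hx.eventually_exists_sampling T, hev, eventually_ge_atTop (⌈T⌉₊ + 1)]
    with n ⟨θ, h1, h2⟩ hn hnT hn0
  refine ⟨θ, fun t => (h1 t).trans hn.le, fun t ht => ?_⟩
  have hn0' : (0 : ℝ) < n := by exact_mod_cast hn0
  -- The cap in `stepPath` is inactive, because `θ t ≤ ⌈T⌉₊ + 1 ≤ n`.
  have hfl : ⌊n * θ t⌋₊ ≤ n ^ 2 := by
    refine Nat.floor_le_of_le ?_
    have h3 : θ t ≤ n := by
      have h4 := h1 t
      rw [NNReal.dist_eq] at h4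
      have h5 := (abs_le.1 h4).2
      have h6 : (1 : ℝ) / n ≤ 1 := by
        rw [div_le_one hn0']; exact_mod_cast hn0
      have h7 : (t : ℝ) ≤ ⌈T⌉₊ := by exact_mod_cast ht.trans (Nat.le_ceil T)
      have h8 : ((⌈T⌉₊ : ℝ) + 1) ≤ n := by exact_mod_cast hnT
      rw [← NNReal.coe_le_coe]
      push_cast
      linarith
    push_cast
    rw [sq]
    gcongr
  have : (stepPath hn0 fun k => g (x (k / n))).1 (θ t) = g (x t) := by
    simp only [stepPath, min_eq_left hfl]
    rw [h2 t ht]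
  rw [this]
  simpa [SkorokhodSpace.image] using hε.le

/-- A process with càdlàg paths in a countable discrete space is a measurable map into the
Skorokhod space. -/
theorem measurable_image {S E Ω : Type*} [TopologicalSpace S] [DiscreteTopology S] [Countable S]
    [MeasurableSpace S] [MeasurableSingletonClass S] [PseudoMetricSpace E] [MeasurableSpace Ω]
    {g : S → E} (hg : Continuous g) {X : ℝ≥0 → Ω → S} (hX : ∀ ω, IsCadlag fun t => X t ω)
    (hm : ∀ t, Measurable (X t)) :
    Measurable fun ω => SkorokhodSpace.image g hg (fun t => X t ω) (hX ω) := by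
  refine measurable_of_isOpen fun U hU => ?_
  set V : ℕ → Set (SkorokhodSpace E) := fun m =>
    {x | ∀ y, SkorokhodClose (1 / (m + 1)) m x y → y ∈ U} with hV
  set Y : ℕ → Ω → SkorokhodSpace E := fun n ω =>
    stepPath n.succ_pos fun k => g (X (k / (n + 1 : ℕ)) ω) with hY
  -- `Y n` factors through finitely many samples in a countable set, so measurability of `V m`
  -- itself is not needed.
  have hYm : ∀ m n, MeasurableSet {ω | Y n ω ∈ V m} := by
    intro m n
    have h1 : Measurable fun ω => (fun k : Fin ((n + 1) ^ 2 + 1) => X (k / (n + 1 : ℕ)) ω) :=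
      measurable_pi_lambda _ fun k => hm _
    exact h1 (Set.to_countable
      {v : Fin ((n + 1) ^ 2 + 1) → S | stepPath n.succ_pos (fun k => g (v k)) ∈ V m}).measurableSet
  have hclose : ∀ ω {ε : ℝ}, 0 < ε → ∀ T : ℝ≥0, ∀ᶠ n in atTop,
      SkorokhodClose ε T (SkorokhodSpace.image g hg (fun t => X t ω) (hX ω)) (Y n ω) := by
    intro ω ε hε T
    filter_upwards [(tendsto_add_atTop_nat 1).eventually
      (eventually_skorokhodClose_stepPath hg (hX ω) hε T)] with n hn using hn _
  -- Membership in the open set `U` means that, for some `m`, the approximations eventually have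
  -- their whole `m`-th neighbourhood inside `U`.
  have hset : (fun ω => SkorokhodSpace.image g hg (fun t => X t ω) (hX ω)) ⁻¹' U =
      ⋃ m, ⋃ n, ⋂ k ≥ n, {ω | Y k ω ∈ V m} := by
    ext ω
    simp only [mem_preimage, mem_iUnion, mem_iInter, mem_ofPred_eq]
    have hpos : ∀ m : ℕ, (0 : ℝ) < 1 / (m + 1) := fun m => by positivity
    constructor
    · intro hω
      obtain ⟨ε, hε, T, hεT⟩ := hU _ hω
      obtain ⟨m, hm⟩ := ((tendsto_one_div_add_atTop_nhds_zero_nat.eventually_lt_const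
        (half_pos hε)).and (eventually_ge_atTop ⌈T + ε.toNNReal⌉₊)).exists
      obtain ⟨hm1, hm2⟩ := hm
      obtain ⟨n, hn⟩ := eventually_atTop.1 (hclose ω (half_pos hε) (T + ε.toNNReal))
      refine ⟨m, n, fun k hk y hy => hεT y ?_⟩
      have h3 : T + ε.toNNReal ≤ m := (Nat.le_ceil _).trans (by exact_mod_cast hm2)
      rw [← add_halves ε]
      refine ((hn k hk).mono le_rfl (show T ≤ T + ε.toNNReal by simp)).trans
        (hy.mono hm1.le le_rfl) ?_
      have h4 : ((T + ε.toNNReal : ℝ≥0) : ℝ) ≤ m := by exact_mod_cast h3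
      rw [NNReal.coe_add, Real.coe_toNNReal _ hε.le] at h4
      rw [NNReal.coe_natCast]
      linarith
    · rintro ⟨m, n, h⟩
      -- Reversing the closeness relation shrinks the window by `1 / (m + 1) ≤ 1`, so `m + 1` leaves
      -- `m`.
      obtain ⟨k, hk1, hk2⟩ := ((hclose ω (hpos m) (m + 1)).and (eventually_ge_atTop n)).exists
      refine h k hk2 _ (hk1.symm ?_)
      push_cast
      gcongr
      rw [div_le_one (by positivity)]
      simp
  rw [hset]
  exact MeasurableSet.iUnion fun m => MeasurableSet.iUnion fun n =>
    MeasurableSet.iInter fun k => MeasurableSet.iInter fun _ => hYm m k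

/-! ### Convergence in distribution to a deterministic path -/

/-- A bounded continuous `f` varies little over the paths close to `x`, and by at most `2 * ‖f‖` on
the remaining event of small probability. The event of non-closeness need not be measurable; it only
dominates the measurable set `A`. -/
theorem tendstoInDistribution_of_measure_not_skorokhodClose {ι E : Type*} [PseudoMetricSpace E]
    {Ω : ι → Type*} {m : ∀ i, MeasurableSpace (Ω i)} {P : ∀ i, Measure (Ω i)}
    [∀ i, IsProbabilityMeasure (P i)] {Y : ∀ i, Ω i → SkorokhodSpace E} {l : Filter ι}
    (hY : ∀ i, Measurable (Y i)) (x : SkorokhodSpace E)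
    (h : ∀ ε : ℝ, 0 < ε → ∀ T : ℝ≥0,
      Tendsto (fun i => P i {ω | ¬ SkorokhodClose ε T x (Y i ω)}) l (𝓝 0)) :
    TendstoInDistribution Y l (fun _ : Unit => x) P (Measure.dirac ()) where
  forall_aemeasurable i := (hY i).aemeasurable
  aemeasurable_limit := measurable_const.aemeasurable
  tendsto := by
    refine ProbabilityMeasure.tendsto_iff_forall_integral_tendsto.2 fun f => ?_
    simp only [ProbabilityMeasure.coe_mk]
    have hfm : Measurable f := f.continuous.measurable
    rw [integral_map measurable_const.aemeasurable hfm.aestronglyMeasurable, integral_dirac,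
      Metric.tendsto_nhds]
    intro η hη
    have hU : IsOpen (f ⁻¹' Metric.ball (f x) (η / 2)) := Metric.isOpen_ball.preimage f.continuous
    obtain ⟨ε, hε, T, hεT⟩ := hU x (by simpa using hη)
    have hC : 0 < 2 * ‖f‖ + 1 := by positivity
    have hev := (h ε hε T).eventually_lt_const
      (show (0 : ℝ≥0∞) < ENNReal.ofReal (η / 2 / (2 * ‖f‖ + 1)) by
        rw [ENNReal.ofReal_pos]; positivity)
    filter_upwards [hev] with i hi
    rw [integral_map (hY i).aemeasurable hfm.aestronglyMeasurable]
    set A : Set (Ω i) := (fun ω => f (Y i ω)) ⁻¹' (Metric.ball (f x) (η / 2))ᶜ with hA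
    have hfY : Measurable fun ω => f (Y i ω) := hfm.comp (hY i)
    have hAm : MeasurableSet A := hfY Metric.isOpen_ball.measurableSet.compl
    have hPA : (P i).real A < η / 2 / (2 * ‖f‖ + 1) := by
      rw [measureReal_def, ← ENNReal.lt_ofReal_iff_toReal_lt (measure_ne_top _ _)]
      refine (measure_mono (t := {ω | ¬ SkorokhodClose ε T x (Y i ω)}) ?_).trans_lt hi
      exact fun ω hω hcl => hω (hεT _ hcl)
    have hint : Integrable (fun ω => f (Y i ω)) (P i) :=
      Integrable.of_bound hfY.aestronglyMeasurable ‖f‖ (ae_of_all _ fun ω => f.norm_coe_le_norm _)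
    have hsub : ∫ ω, f (Y i ω) ∂P i - f x = ∫ ω, (f (Y i ω) - f x) ∂P i := by
      rw [integral_sub hint (integrable_const _)]
      simp
    have hbound : ∀ ω, ‖f (Y i ω) - f x‖ ≤ η / 2 + A.indicator (fun _ => 2 * ‖f‖) ω := by
      intro ω
      by_cases hω : ω ∈ A
      · rw [indicator_of_mem hω]
        have := norm_sub_le (f (Y i ω)) (f x)
        linarith [f.norm_coe_le_norm (Y i ω), f.norm_coe_le_norm x]
      · rw [indicator_of_notMem hω, add_zero]
        have : f (Y i ω) ∈ Metric.ball (f x) (η / 2) := by simpa [hA] using hω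
        exact (mem_ball_iff_norm.1 this).le
    have hgi : Integrable (fun ω => η / 2 + A.indicator (fun _ => 2 * ‖f‖) ω) (P i) :=
      (integrable_const _).add ((integrable_const _).indicator hAm)
    rw [Real.dist_eq, hsub, ← Real.norm_eq_abs]
    calc ‖∫ ω, (f (Y i ω) - f x) ∂P i‖
        ≤ ∫ ω, (η / 2 + A.indicator (fun _ => 2 * ‖f‖) ω) ∂P i :=
          norm_integral_le_of_norm_le hgi (ae_of_all _ hbound)
      _ = η / 2 + (P i).real A * (2 * ‖f‖) := by
          rw [integral_add (integrable_const _) ((integrable_const _).indicator hAm),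
            integral_indicator_const _ hAm]
          simp
      _ < η / 2 + η / 2 := by
          rw [lt_div_iff₀ hC] at hPA
          have : 0 ≤ (P i).real A := measureReal_nonneg
          nlinarith
      _ = η := add_halves η

/-! ### Markov jump processes on a finite set -/

section Exp

variable {S : Type*} [Fintype S] [DecidableEq S]

attribute [local instance] Matrix.linftyOpNormedRing Matrix.linftyOpNormedAlgebra

theorem matrix_exp_nonneg {M : Matrix S S ℝ} (hM : ∀ i j, 0 ≤ M i j) (i j : S) :
    0 ≤ NormedSpace.exp M i j := by
  have hpow : ∀ n : ℕ, ∀ i j, 0 ≤ (M ^ n) i j := by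
    intro n
    induction n with
    | zero =>
      intro i j
      rw [pow_zero, Matrix.one_apply]
      split_ifs <;> norm_num
    | succ n ih =>
      intro i j
      rw [pow_succ, Matrix.mul_apply]
      exact Finset.sum_nonneg fun k _ => mul_nonneg (ih i k) (hM k j)
  have hs := (NormedSpace.exp_series_hasSum_exp' (𝕂 := ℝ) M).map (Matrix.entryAddMonoidHom ℝ i j)
    (continuous_id.matrix_elem i j)
  exact hs.nonneg fun n => mul_nonneg (by positivity) (hpow n i j)

/-- Adding a large multiple of the identity makes `Q` entrywise nonnegative, and only multiplies the
exponential by a positive scalar. -/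
theorem matrix_exp_smul_nonneg {Q : Matrix S S ℝ} (hQ : ∀ i j, i ≠ j → 0 ≤ Q i j) {h : ℝ}
    (hh : 0 ≤ h) (i j : S) : 0 ≤ NormedSpace.exp (h • Q) i j := by
  set c : ℝ := ∑ k, |Q k k| with hc
  have hsplit : h • Q = h • (Q + c • (1 : Matrix S S ℝ)) + Matrix.diagonal fun _ : S => -(h * c) := by
    rw [smul_add, add_assoc, smul_smul, Matrix.smul_one_eq_diagonal, Matrix.diagonal_add]
    simp
  have hcomm : Commute (h • (Q + c • (1 : Matrix S S ℝ))) (Matrix.diagonal fun _ : S => -(h * c)) := by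
    rw [← Matrix.smul_one_eq_diagonal]
    exact (Commute.one_right _).smul_right _
  rw [hsplit, Matrix.exp_add_of_commute _ _ hcomm, Matrix.exp_diagonal, Matrix.mul_diagonal]
  refine mul_nonneg (matrix_exp_nonneg (fun k l => ?_) i j) ?_
  · simp only [Matrix.smul_apply, Matrix.add_apply, smul_eq_mul]
    refine mul_nonneg hh ?_
    by_cases hkl : k = l
    · subst hkl
      have h1 : |Q k k| ≤ c := Finset.single_le_sum (f := fun k => |Q k k|)
        (fun _ _ => abs_nonneg _) (Finset.mem_univ k)
      rw [Matrix.one_apply_eq, mul_one]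
      linarith [neg_abs_le (Q k k)]
    · rw [Matrix.one_apply_ne hkl]
      simpa using hQ k l hkl
  · rw [Pi.coe_exp, ← Real.exp_eq_exp_ℝ]
    exact (Real.exp_pos _).le

/-- If `∂φ/∂t + Q φ ≤ 0` then `exp (h Q) φ(t + h) ≤ φ(t)`. -/
theorem exp_smul_mulVec_le {Q : Matrix S S ℝ} (hQ : ∀ i j, i ≠ j → 0 ≤ Q i j)
    {φ φ' : ℝ → S → ℝ} (hd : ∀ t z, HasDerivAt (fun t => φ t z) (φ' t z) t)
    (hgen : ∀ t, 0 ≤ t → ∀ z, φ' t z + Q.mulVec (φ t) z ≤ 0) {t h : ℝ} (ht : 0 ≤ t) (hh : 0 ≤ h)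
    (i : S) : ∑ j, NormedSpace.exp (h • Q) i j * φ (t + h) j ≤ φ t i := by
  have hexp : ∀ (r : ℝ) (j : S), HasDerivAt (fun r : ℝ => NormedSpace.exp (r • Q) i j)
      ((NormedSpace.exp (r • Q) * Q) i j) r := by
    intro r j
    have h1 := hasDerivAt_exp_smul_const Q r
    exact hasDerivAt_pi.1 (hasDerivAt_pi.1 h1 i) j
  -- Kolmogorov's forward equation puts the whole derivative in the form `exp (r Q) (φ' + Q φ)`,
  -- whose sign is then known.
  have hder : ∀ r, HasDerivAt (fun r => ∑ j, NormedSpace.exp (r • Q) i j * φ (t + r) j)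
      (∑ j, NormedSpace.exp (r • Q) i j * (φ' (t + r) j + Q.mulVec (φ (t + r)) j)) r := by
    intro r
    have h1 : HasDerivAt (fun r => ∑ j, NormedSpace.exp (r • Q) i j * φ (t + r) j)
        (∑ j, ((NormedSpace.exp (r • Q) * Q) i j * φ (t + r) j +
          NormedSpace.exp (r • Q) i j * φ' (t + r) j)) r := by
      refine HasDerivAt.fun_sum fun j _ => (hexp r j).mul ?_
      exact (hd (t + r) j).comp_const_add t r
    convert h1 using 1
    have h2 : (∑ j, (NormedSpace.exp (r • Q) * Q) i j * φ (t + r) j) =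
        ∑ j, NormedSpace.exp (r • Q) i j * Q.mulVec (φ (t + r)) j := by
      exact congrFun (Matrix.mulVec_mulVec (φ (t + r)) (NormedSpace.exp (r • Q)) Q).symm i
    rw [Finset.sum_add_distrib, h2, ← Finset.sum_add_distrib]
    exact Finset.sum_congr rfl fun j _ => by ring
  have hanti : AntitoneOn (fun r => ∑ j, NormedSpace.exp (r • Q) i j * φ (t + r) j) (Ici 0) := by
    refine antitoneOn_of_deriv_nonpos (convex_Ici 0)
      (fun r _ => (hder r).continuousAt.continuousWithinAt)
      (fun r _ => (hder r).differentiableAt.differentiableWithinAt) fun r hr => ?_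
    rw [interior_Ici] at hr
    rw [(hder r).deriv]
    exact Finset.sum_nonpos fun j _ => mul_nonpos_of_nonneg_of_nonpos
      (matrix_exp_smul_nonneg hQ (le_of_lt hr) i j) (hgen _ (add_nonneg ht (le_of_lt hr)) j)
  have := hanti (mem_Ici.2 le_rfl) (mem_Ici.2 hh) hh
  simpa [Matrix.one_apply] using this

end Exp

namespace IsMarkovJumpProcess

variable {S Ω : Type*} [Fintype S] [DecidableEq S] [TopologicalSpace S] [MeasurableSpace S]
  {m : MeasurableSpace Ω} {P : Measure Ω} {ℱ : Filtration ℝ≥0 m} {Q : Matrix S S ℝ} {X : ℝ≥0 → Ω → S}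

theorem measurable (hX : IsMarkovJumpProcess P ℱ Q X) (t : ℝ≥0) : Measurable (X t) :=
  (hX.adapted t).mono (ℱ.le t) le_rfl

variable [MeasurableSingletonClass S] [IsProbabilityMeasure P]

theorem integrable_comp (hX : IsMarkovJumpProcess P ℱ Q X) (f : S → ℝ) (t : ℝ≥0) :
    Integrable (fun ω => f (X t ω)) P :=
  Integrable.of_bound ((measurable_of_countable f).comp (hX.measurable t)).aestronglyMeasurable
    (∑ z, ‖f z‖) (ae_of_all _ fun ω => Finset.single_le_sum (f := fun z => ‖f z‖)
      (fun _ _ => norm_nonneg _) (Finset.mem_univ (X t ω)))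

theorem setIntegral_comp_add (hX : IsMarkovJumpProcess P ℱ Q X) (f : S → ℝ) (s h : ℝ≥0)
    {A : Set Ω} (hA : MeasurableSet[ℱ s] A) :
    ∫ ω in A, f (X (s + h) ω) ∂P =
      ∫ ω in A, ∑ j, NormedSpace.exp ((h : ℝ) • Q) (X s ω) j * f j ∂P := by
  have hstep : ∀ j, ∫ ω in A, (if X (s + h) ω = j then (1 : ℝ) else 0) ∂P =
      ∫ ω in A, NormedSpace.exp ((h : ℝ) • Q) (X s ω) j ∂P := by
    intro j
    rw [← setIntegral_condExp (ℱ.le s)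
      (hX.integrable_comp (fun z => if z = j then (1 : ℝ) else 0) (s + h)) hA]
    exact setIntegral_congr_ae (ℱ.le s _ hA) ((hX.markov s h j).mono fun ω hω _ => hω)
  have hsum : ∀ ω, f (X (s + h) ω) = ∑ j, (if X (s + h) ω = j then (1 : ℝ) else 0) * f j := by
    intro ω
    simp
  simp_rw [hsum]
  rw [integral_finsetSum, integral_finsetSum]
  · refine Finset.sum_congr rfl fun j _ => ?_
    rw [integral_mul_const, integral_mul_const, hstep]
  · exact fun j _ =>
      ((hX.integrable_comp (fun z => NormedSpace.exp ((h : ℝ) • Q) z j) s).mul_const _).integrableOn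
  · exact fun j _ => ((hX.integrable_comp
      (fun z => if z = j then (1 : ℝ) else 0) (s + h)).mul_const _).integrableOn

section Supersolution

variable {φ φ' : ℝ → S → ℝ}

/-- This is the supermartingale property of `φ(t, X(t))`, tested on events of the past. -/
theorem setIntegral_le (hX : IsMarkovJumpProcess P ℱ Q X) (hQ : ∀ i j, i ≠ j → 0 ≤ Q i j)
    (hd : ∀ t z, HasDerivAt (fun t => φ t z) (φ' t z) t)
    (hgen : ∀ t, 0 ≤ t → ∀ z, φ' t z + Q.mulVec (φ t) z ≤ 0) {s t : ℝ≥0} (hst : s ≤ t)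
    {A : Set Ω} (hA : MeasurableSet[ℱ s] A) :
    ∫ ω in A, φ t (X t ω) ∂P ≤ ∫ ω in A, φ s (X s ω) ∂P := by
  obtain ⟨h, rfl⟩ := exists_add_of_le hst
  rw [hX.setIntegral_comp_add (φ (s + h : ℝ≥0)) s h hA]
  refine setIntegral_mono (hX.integrable_comp
    (fun z => ∑ j, NormedSpace.exp ((h : ℝ) • Q) z j * φ (s + h : ℝ≥0) j) s).integrableOn
    (hX.integrable_comp (φ s) s).integrableOn fun ω => ?_
  have := exp_smul_mulVec_le hQ hd hgen s.2 h.2 (X s ω)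
  push_cast
  exact this

/-- Doob's maximal inequality along discrete times, by induction instead of optional stopping: the
newly exceeding event contributes at least `a` times its probability, and the supermartingale
property carries the rest one step on. No sign of `φ` is needed, since the integral over the
complement is kept. -/
theorem mul_measure_exists_le (hX : IsMarkovJumpProcess P ℱ Q X)
    (hQ : ∀ i j, i ≠ j → 0 ≤ Q i j) (hd : ∀ t z, HasDerivAt (fun t => φ t z) (φ' t z) t)
    (hgen : ∀ t, 0 ≤ t → ∀ z, φ' t z + Q.mulVec (φ t) z ≤ 0) (a : ℝ)
    {τ : ℕ → ℝ≥0} (hτ : Monotone τ) (hτ0 : τ 0 = 0) (n : ℕ) :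
    a * P.real {ω | ∃ k < n, a ≤ φ (τ k) (X (τ k) ω)} +
        ∫ ω in {ω | ∃ k < n, a ≤ φ (τ k) (X (τ k) ω)}ᶜ, φ (τ n) (X (τ n) ω) ∂P ≤
      ∫ ω, φ 0 (X 0 ω) ∂P := by
  set A : ℕ → Set Ω := fun n => {ω | ∃ k < n, a ≤ φ (τ k) (X (τ k) ω)} with hA
  set B : ℕ → Set Ω := fun k => {ω | a ≤ φ (τ k) (X (τ k) ω)} with hB
  have hBm : ∀ k, MeasurableSet[ℱ (τ k)] (B k) := fun k =>
    hX.adapted (τ k) (Set.to_countable {z | a ≤ φ (τ k) z}).measurableSet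
  have hAB : ∀ n, A (n + 1) = A n ∪ B n := fun n => by
    ext ω
    simp only [hA, hB, mem_ofPred_eq, mem_union, Nat.lt_succ_iff_lt_or_eq]
    constructor
    · rintro ⟨k, hk | rfl, h⟩
      exacts [Or.inl ⟨k, hk, h⟩, Or.inr h]
    · rintro (⟨k, hk, h⟩ | h)
      exacts [⟨k, Or.inl hk, h⟩, ⟨n, Or.inr rfl, h⟩]
  have hAm : ∀ n, MeasurableSet[ℱ (τ n)] (A n) := by
    intro n
    induction n with
    | zero => simp [hA]
    | succ n ih =>
      rw [hAB]
      exact ℱ.mono (hτ n.le_succ) _ (ih.union (hBm n))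
  have hAm' : ∀ n, MeasurableSet (A n) := fun n => ℱ.le _ _ (hAm n)
  have hBm' : ∀ n, MeasurableSet (B n) := fun n => ℱ.le _ _ (hBm n)
  change a * P.real (A n) + ∫ ω in (A n)ᶜ, φ (τ n) (X (τ n) ω) ∂P ≤ _
  induction n with
  | zero => simp [hA, hτ0]
  | succ n ih =>
    have h1 : P.real (A (n + 1)) = P.real (A n) + P.real ((A n)ᶜ ∩ B n) := by
      rw [← measureReal_union (disjoint_compl_right.mono_right inter_subset_left)
        ((hAm' n).compl.inter (hBm' n)), hAB]
      congr 1
      ext ω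
      by_cases h : ω ∈ A n <;> simp [h]
    have h2 : (A n)ᶜ \ B n = (A (n + 1))ᶜ := by
      rw [hAB, compl_union, sdiff_eq]
    have hint := hX.integrable_comp (φ (τ n)) (τ n)
    have h3 := integral_inter_add_sdiff (μ := P) (s := (A n)ᶜ) (hBm' n) hint.integrableOn
    have h4 : a * P.real ((A n)ᶜ ∩ B n) ≤ ∫ ω in (A n)ᶜ ∩ B n, φ (τ n) (X (τ n) ω) ∂P := by
      have := setIntegral_mono_on (μ := P) (s := (A n)ᶜ ∩ B n) (f := fun _ => a)
        (integrable_const a).integrableOn hint.integrableOn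
        ((hAm' n).compl.inter (hBm' n)) fun ω hω => hω.2
      rwa [setIntegral_const, smul_eq_mul, mul_comm] at this
    have hAs : MeasurableSet[ℱ (τ n)] (A (n + 1))ᶜ := by
      rw [hAB]
      exact ((hAm n).union (hBm n)).compl
    have h5 := hX.setIntegral_le hQ hd hgen (hτ n.le_succ) hAs
    rw [h2] at h3
    rw [h1]
    linarith

/-- Maximal inequality for the supermartingale `φ(t, X(t))`. -/
theorem measure_exists_lt_le [DiscreteTopology S] (hX : IsMarkovJumpProcess P ℱ Q X)
    (hQ : ∀ i j, i ≠ j → 0 ≤ Q i j) (hd : ∀ t z, HasDerivAt (fun t => φ t z) (φ' t z) t)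
    (hgen : ∀ t, 0 ≤ t → ∀ z, φ' t z + Q.mulVec (φ t) z ≤ 0) {T : ℝ≥0}
    (hpos : ∀ t ≤ T, ∀ z, 0 ≤ φ t z) {a : ℝ} (ha : 0 < a) :
    P {ω | ∃ t < T, a < φ t (X t ω)} ≤ ENNReal.ofReal ((∫ ω, φ 0 (X 0 ω) ∂P) / a) := by
  set A : ℕ → Set Ω := fun n => {ω | ∃ k < n, a ≤ φ (T * k / n : ℝ≥0) (X (T * k / n) ω)} with hA
  have hPA : ∀ n, 0 < n → P (A n) ≤ ENNReal.ofReal ((∫ ω, φ 0 (X 0 ω) ∂P) / a) := by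
    intro n hn
    have hmono : Monotone fun k : ℕ => T * k / n := fun k l hkl => by
      simp only
      gcongr
    have hle := hX.mul_measure_exists_le hQ hd hgen a hmono (by simp) n
    have hnonneg : ∀ ω, 0 ≤ φ (T * n / n : ℝ≥0) (X (T * n / n) ω) := fun ω => by
      refine hpos _ (le_of_eq ?_) _
      exact mul_div_cancel_right₀ _ (by exact_mod_cast hn.ne')
    rw [← ofReal_measureReal]
    refine ENNReal.ofReal_le_ofReal ?_
    rw [le_div_iff₀ ha, mul_comm]
    have : 0 ≤ ∫ ω in (A n)ᶜ, φ (T * n / n : ℝ≥0) (X (T * n / n) ω) ∂P := integral_nonneg hnonneg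
    linarith
  -- By right continuity a strict exceedance persists just after `t < T`, so every fine enough grid
  -- detects it. The grids are not nested, hence the liminf of events.
  have hsub : {ω | ∃ t < T, a < φ t (X t ω)} ⊆ ⋃ n, ⋂ k ≥ n, A (k + 1) := by
    rintro ω ⟨t, htT, ht⟩
    have hT : (0 : ℝ≥0) < T := zero_le.trans_lt htT
    have hev : ∀ᶠ r : ℝ≥0 in 𝓝[≥] t, a < φ r (X r ω) := by
      have h1 : ∀ᶠ r : ℝ≥0 in 𝓝 t, a < φ r (X t ω) :=
        ((hd t (X t ω)).continuousAt.comp NNReal.continuous_coe.continuousAt).eventually_const_lt ht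
      have h2 : ∀ᶠ r in 𝓝[≥] t, X r ω = X t ω :=
        (hX.cadlag ω t).1 (show {X t ω} ∈ 𝓝 (X t ω) by simp)
      filter_upwards [h1.filter_mono nhdsWithin_le_nhds, h2] with r hr1 hr2
      rwa [hr2]
    -- The first point at or after `t` of the grid of mesh `T / (n + 1)`.
    set r : ℕ → ℝ≥0 := fun n => T * ⌈t / T * (n + 1 : ℕ)⌉₊ / (n + 1 : ℕ) with hr
    have hn0 : ∀ n : ℕ, (0 : ℝ≥0) < (n + 1 : ℕ) := fun n => by positivity
    have hr1 : ∀ n, t ≤ r n := fun n => by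
      rw [hr, le_div_iff₀ (hn0 n), ← div_le_iff₀' hT, mul_div_right_comm]
      exact Nat.le_ceil _
    have hr2 : ∀ n, r n ≤ t + T * (1 / ((n : ℝ≥0) + 1)) := fun n => by
      have h1 : (⌈t / T * (n + 1 : ℕ)⌉₊ : ℝ≥0) ≤ t / T * (n + 1 : ℕ) + 1 :=
        (Nat.ceil_lt_add_one zero_le).le
      calc r n ≤ T * (t / T * (n + 1 : ℕ) + 1) / (n + 1 : ℕ) := by
            simp only [hr]
            gcongr
        _ = t + T * (1 / ((n : ℝ≥0) + 1)) := by
            have := hT.ne'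
            have := (hn0 n).ne'
            push_cast at this ⊢
            field_simp
    have hlim : Tendsto (fun n : ℕ => t + T * (1 / ((n : ℝ≥0) + 1))) atTop (𝓝 t) := by
      have h1 : Tendsto (fun n : ℕ => 1 / ((n : ℝ≥0) + 1)) atTop (𝓝 0) :=
        tendsto_one_div_add_atTop_nhds_zero_nat
      simpa using (h1.const_mul T).const_add t
    have hrt : Tendsto r atTop (𝓝 t) :=
      tendsto_of_tendsto_of_tendsto_of_le_of_le tendsto_const_nhds hlim hr1 hr2
    have hrt' : Tendsto r atTop (𝓝[≥] t) :=
      tendsto_nhdsWithin_iff.2 ⟨hrt, Eventually.of_forall hr1⟩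
    obtain ⟨n, hn⟩ := eventually_atTop.1
      ((hrt'.eventually hev).and (hrt.eventually_lt_const htT))
    refine mem_iUnion.2 ⟨n, mem_iInter₂.2 fun k hk => ⟨⌈t / T * (k + 1 : ℕ)⌉₊, ?_, (hn k hk).1.le⟩⟩
    have h1 := (hn k hk).2
    rw [hr, div_lt_iff₀ (hn0 k)] at h1
    exact_mod_cast lt_of_mul_lt_mul_left h1 zero_le
  refine (measure_mono hsub).trans ?_
  have hmono : Monotone fun n => ⋂ k ≥ n, A (k + 1) := fun n l hnl =>
    biInter_mono (fun k hk => le_trans hnl hk) fun _ _ => le_rfl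
  refine le_of_tendsto' (tendsto_measure_iUnion_atTop hmono) fun n => ?_
  exact (measure_mono (biInter_subset_of_mem (mem_ofPred_eq ▸ le_refl n))).trans (hPA _ n.succ_pos)

end Supersolution

end IsMarkovJumpProcess

/-! ### The generator of the storage network -/

theorem jumpRate_nonneg {lam mu : ℝ} (hlam : 0 ≤ lam) (hmu : 0 ≤ mu) (N F : ℕ) (x : State F)
    (y : ℕ × ℕ) : 0 ≤ jumpRate lam mu N F x.1 y := by
  have h : (x.1.1 : ℝ) + x.1.2 ≤ F := by exact_mod_cast x.2
  have h' : 0 ≤ (F : ℝ) - x.1.1 - x.1.2 := by linarith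
  unfold jumpRate
  split_ifs <;> positivity

theorem qMatrix_nonneg {lam mu : ℝ} (hlam : 0 ≤ lam) (hmu : 0 ≤ mu) (N F : ℕ) (x y : State F)
    (hxy : x ≠ y) : 0 ≤ qMatrix lam mu N F x y := by
  rw [qMatrix, Matrix.of_apply, if_neg hxy]
  exact jumpRate_nonneg hlam hmu N F x y.1

theorem sum_state_ite {F : ℕ} (w : ℕ × ℕ) (f : ℕ × ℕ → ℝ) :
    ∑ z : State F, (if z.1 = w then f z.1 else 0) = if w.1 + w.2 ≤ F then f w else 0 := by
  split_ifs with hw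
  · rw [Finset.sum_eq_single (⟨w, hw⟩ : State F)]
    · simp
    · intro z _ hz
      rw [if_neg fun h => hz (Subtype.ext h)]
    · simp
  · refine Finset.sum_eq_zero fun z _ => if_neg fun h => hw ?_
    rw [← h]
    exact z.2

theorem qMatrix_mulVec (lam mu : ℝ) (N F : ℕ) (f : ℕ × ℕ → ℝ) (x : State F) :
    (qMatrix lam mu N F).mulVec (fun z => f z.1) x =
      2 * mu * ((F : ℝ) - x.1.1 - x.1.2) * (f (x.1.1, x.1.2 + 1) - f x.1) +
      (if 0 < x.1.2 then lam * N * (f (x.1.1, x.1.2 - 1) - f x.1) else 0) +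
      mu * x.1.2 * (f (x.1.1 + 1, x.1.2 - 1) - f x.1) := by
  have h1 : (qMatrix lam mu N F).mulVec (fun z => f z.1) x =
      ∑ z : State F, jumpRate lam mu N F x.1 z.1 * (f z.1 - f x.1) := by
    rw [Matrix.mulVec, dotProduct, ← Finset.add_sum_erase _ _ (Finset.mem_univ x),
      ← Finset.add_sum_erase Finset.univ (fun z : State F => jumpRate lam mu N F x.1 z.1 *
        (f z.1 - f x.1)) (Finset.mem_univ x)]
    simp only [qMatrix, Matrix.of_apply, if_true, sub_self, mul_zero, zero_add, neg_mul,
      Finset.sum_mul]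
    rw [neg_add_eq_sub, ← Finset.sum_sub_distrib]
    refine Finset.sum_congr rfl fun z hz => ?_
    rw [if_neg (Finset.ne_of_mem_erase hz).symm]
    ring
  obtain ⟨⟨x₀, x₁⟩, hx⟩ := x
  rw [h1]
  simp only at hx ⊢
  -- The upward jump leaves the state space only when `x₀ + x₁ = F`, where its rate vanishes.
  have hup : (if (x₀, x₁ + 1).1 + (x₀, x₁ + 1).2 ≤ F then
      2 * mu * ((F : ℝ) - x₀ - x₁) * (f (x₀, x₁ + 1) - f (x₀, x₁)) else 0) =
      2 * mu * ((F : ℝ) - x₀ - x₁) * (f (x₀, x₁ + 1) - f (x₀, x₁)) := by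
    split_ifs with h
    · rfl
    · have : F = x₀ + x₁ := by simp only at h; omega
      subst this
      push_cast
      ring
  rcases Nat.eq_zero_or_pos x₁ with rfl | hpos
  · simp only [lt_self_iff_false, if_false, Nat.cast_zero, mul_zero, zero_mul, add_zero]
    simp only [Nat.cast_zero] at hup
    rw [← hup, ← sum_state_ite (x₀, 0 + 1)
      (fun w => 2 * mu * ((F : ℝ) - x₀ - 0) * (f w - f (x₀, 0)))]
    refine Finset.sum_congr rfl fun z _ => ?_
    simp [jumpRate, Prod.ext_iff]
  · obtain ⟨k, rfl⟩ := Nat.exists_eq_succ_of_ne_zero hpos.ne'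
    have hd := sum_state_ite (F := F) (x₀, k) (fun w => lam * N * (f w - f (x₀, k + 1)))
    have hl := sum_state_ite (F := F) (x₀ + 1, k)
      (fun w => mu * (k + 1 : ℕ) * (f w - f (x₀, k + 1)))
    rw [if_pos (by simp only; omega)] at hd hl
    rw [← hup, ← sum_state_ite (x₀, k + 1 + 1)
      (fun w => 2 * mu * ((F : ℝ) - x₀ - (k + 1 : ℕ)) * (f w - f (x₀, k + 1))), if_pos hpos]
    simp only [Nat.succ_eq_add_one, Nat.add_sub_cancel]
    rw [← hd, ← hl, ← Finset.sum_add_distrib, ← Finset.sum_add_distrib]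
    refine Finset.sum_congr rfl fun z _ => ?_
    obtain ⟨⟨z₀, z₁⟩, hz⟩ := z
    simp only [jumpRate, Prod.mk.injEq, Nat.add_right_cancel_iff]
    by_cases h0 : z₀ = x₀ ∧ z₁ = k + 1 + 1
    · rw [if_pos h0, if_pos h0, if_neg (by omega), if_neg (by omega)]; ring
    by_cases h2 : z₀ = x₀ ∧ z₁ = k
    · rw [if_neg h0, if_pos h2, if_neg h0, if_pos h2, if_neg (by omega)]; ring
    by_cases h3 : z₀ = x₀ + 1 ∧ z₁ = k
    · rw [if_neg h0, if_neg h2, if_pos h3, if_neg h0, if_neg h2, if_pos h3]; ring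
    · rw [if_neg h0, if_neg h2, if_neg h3, if_neg h0, if_neg h2, if_neg h3]; ring

/-! ### The fluid limit -/

/-- `(p, q)` solves the fluid equations; `h` is the limiting proportion of the time during which
the duplication capacity is in use. -/
structure IsFluidSolution (lam mu β h : ℝ) (p q : ℝ → ℝ) : Prop where
  hasDerivAt_fst : ∀ t, HasDerivAt p (mu * q t) t
  hasDerivAt_snd : ∀ t, HasDerivAt q (2 * mu * (β - p t - q t) - lam * h - mu * q t) t
  fst_zero : p 0 = 0
  snd_zero : q 0 = 0
  snd_nonneg : ∀ t, 0 ≤ t → 0 ≤ q t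
  le_one : h ≤ 1
  nonneg : 0 ≤ h
  snd_mul : ∀ t, q t * (1 - h) = 0

/-- The squared distance between the rescaled state `z / N` and `(p, q)`. -/
noncomputable def sqDist (N : ℕ) (p q : ℝ) (z : ℕ × ℕ) : ℝ :=
  (z.1 / N - p) ^ 2 + (z.2 / N - q) ^ 2

theorem sqDist_nonneg (N : ℕ) (p q : ℝ) (z : ℕ × ℕ) : 0 ≤ sqDist N p q z := by
  unfold sqDist
  positivity

/-- The rate of growth of the mean squared distance to the fluid limit. -/
noncomputable def fluidError (lam mu β : ℝ) (N F : ℕ) : ℝ :=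
  mu * ((F : ℝ) / N - β) ^ 2 + (2 * mu * ((F : ℝ) / N) + lam) * (1 / N)

theorem fluidError_nonneg {lam mu : ℝ} (hlam : 0 ≤ lam) (hmu : 0 ≤ mu) (β : ℝ) (N F : ℕ) :
    0 ≤ fluidError lam mu β N F := by
  unfold fluidError
  positivity

/-- The jumps contribute the drift of `X / N` against the gradient, plus second-order terms of size
`1 / N`. The `lam * h` terms cancel after the bound `hdown`, and the remaining drift is linear in
the deviations and in `F / N - β`. -/
theorem qMatrix_mulVec_sqDist_le {lam mu β h : ℝ} (hlam : 0 ≤ lam) (hmu : 0 ≤ mu) {N F : ℕ}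
    (hN : 0 < N) {p q : ℝ} (hq : 0 ≤ q) (hh : 0 ≤ h) (hh1 : h ≤ 1) (hqh : q * (1 - h) = 0)
    (x : State F) :
    -2 * (x.1.1 / N - p) * (mu * q) -
        2 * (x.1.2 / N - q) * (2 * mu * (β - p - q) - lam * h - mu * q) +
      (qMatrix lam mu N F).mulVec (fun z => sqDist N p q z.1) x ≤
      mu * sqDist N p q x.1 + fluidError lam mu β N F := by
  rw [qMatrix_mulVec]
  obtain ⟨⟨x₀, x₁⟩, hx⟩ := x
  have hN' : (0 : ℝ) < N := by exact_mod_cast hN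
  set u : ℝ := x₀ / N with hu
  set v : ℝ := x₁ / N with hv
  set f : ℝ := F / N with hf
  set e : ℝ := 1 / N with he
  have he0 : 0 < e := by positivity
  have hu0 : 0 ≤ u := by positivity
  have hv0 : 0 ≤ v := by positivity
  have hx₀ : (x₀ : ℝ) = u * N := by rw [hu]; field_simp
  have hx₁ : (x₁ : ℝ) = v * N := by rw [hv]; field_simp
  have hFf : (F : ℝ) = f * N := by rw [hf]; field_simp
  have heN : (N : ℝ) * e = 1 := by rw [he]; field_simp
  have hup : 2 * mu * ((F : ℝ) - x₀ - x₁) *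
      (sqDist N p q (x₀, x₁ + 1) - sqDist N p q (x₀, x₁)) =
      2 * mu * (f - u - v) * (2 * (v - q) + e) := by
    have : ((x₁ + 1 : ℕ) : ℝ) / N = v + e := by push_cast; rw [add_div]
    simp only [sqDist, this, ← hu, ← hv]
    rw [hx₀, hx₁, hFf]
    linear_combination (2 * mu * (f - u - v) * (2 * (v - q) + e)) * heN
  -- Monotonicity of the reflection: `(v - q) * (h - 1_{v > 0}) ≤ 0`. For `v = 0` it is `-q * h`;
  -- for `v > 0` the condition `q * (1 - h) = 0` leaves `-v * (1 - h)`.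
  have hdown : (if 0 < x₁ then lam * N *
      (sqDist N p q (x₀, x₁ - 1) - sqDist N p q (x₀, x₁)) else 0) ≤
      -2 * lam * h * (v - q) + lam * e := by
    rcases Nat.eq_zero_or_pos x₁ with h0 | hpos
    · have hv' : v = 0 := by rw [hv, h0]; simp
      rw [if_neg (by omega), hv']
      have : 0 ≤ lam * h * q := by positivity
      have : 0 ≤ lam * e := by positivity
      linarith
    · have : ((x₁ - 1 : ℕ) : ℝ) / N = v - e := by
        rw [Nat.cast_sub hpos, sub_div, Nat.cast_one]
      rw [if_pos hpos]
      simp only [sqDist, this, ← hu, ← hv]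
      have h1 : 0 ≤ lam * (1 - h) * v := mul_nonneg (mul_nonneg hlam (by linarith)) hv0
      have h2 : lam * N * ((u - p) ^ 2 + (v - e - q) ^ 2 - ((u - p) ^ 2 + (v - q) ^ 2)) =
          lam * (-2 * (v - q) + e) := by
        linear_combination (lam * (-2 * (v - q) + e)) * heN
      rw [h2]
      linear_combination 2 * h1 + 2 * lam * hqh
  have hlost : mu * x₁ * (sqDist N p q (x₀ + 1, x₁ - 1) - sqDist N p q (x₀, x₁)) =
      mu * v * (2 * (u - p) - 2 * (v - q) + 2 * e) := by
    rcases Nat.eq_zero_or_pos x₁ with h0 | hpos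
    · have hv' : v = 0 := by rw [hv, h0]; simp
      rw [hv', h0]
      simp
    · have h1 : ((x₁ - 1 : ℕ) : ℝ) / N = v - e := by
        rw [Nat.cast_sub hpos, sub_div, Nat.cast_one]
      have h2 : ((x₀ + 1 : ℕ) : ℝ) / N = u + e := by push_cast; rw [add_div]
      simp only [sqDist, h1, h2, ← hu, ← hv]
      rw [hx₁]
      linear_combination (mu * v * (2 * (u - p) - 2 * (v - q) + 2 * e)) * heN
  rw [hup, hlost]
  have hs : sqDist N p q (x₀, x₁) = (u - p) ^ 2 + (v - q) ^ 2 := rfl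
  have herr : fluidError lam mu β N F = mu * (f - β) ^ 2 + (2 * mu * f + lam) * e := rfl
  rw [hs] at hdown ⊢
  rw [herr]
  -- Completing squares absorbs the cross terms `(u - p) * (v - q)` and `(f - β) * (v - q)`.
  have h1 : 0 ≤ mu * (u - p + (v - q)) ^ 2 := by positivity
  have h2 : 0 ≤ mu * (f - β - 2 * (v - q)) ^ 2 := by positivity
  have h3 : 0 ≤ mu * u * e := by positivity
  have h4 : 0 ≤ mu * (v - q) ^ 2 := by positivity
  linear_combination hdown + h1 + h2 + 2 * h3 + 2 * h4

/-- The process stays close to the fluid limit. -/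
theorem measure_exists_lt_sqDist_le {lam mu β h : ℝ} (hlam : 0 ≤ lam) (hmu : 0 ≤ mu) {N F : ℕ}
    (hN : 0 < N) {p q : ℝ → ℝ} (hpq : IsFluidSolution lam mu β h p q) {Ω : Type*}
    {m : MeasurableSpace Ω} {P : Measure Ω} [IsProbabilityMeasure P] {ℱ : Filtration ℝ≥0 m}
    {X : ℝ≥0 → Ω → State F} (hX : IsMarkovJumpProcess P ℱ (qMatrix lam mu N F) X)
    {y : ℕ × ℕ} (hX0 : ∀ᵐ ω ∂P, (X 0 ω).1 = y) (T : ℝ≥0) {b : ℝ} (hb : 0 < b) :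
    P {ω | ∃ t < T, b < sqDist N (p t) (q t) (X t ω).1} ≤
      ENNReal.ofReal ((sqDist N 0 0 y + fluidError lam mu β N F * T) /
        (Real.exp (-mu * T) * b)) := by
  set K := fluidError lam mu β N F with hK
  have hK0 : 0 ≤ K := fluidError_nonneg hlam hmu β N F
  -- The discount cancels the growth rate `mu`; the term `K * (T - t)` pays for the error and stays
  -- nonnegative up to `T`.
  set φ : ℝ → State F → ℝ := fun t z =>
    Real.exp (-mu * t) * sqDist N (p t) (q t) z.1 + K * (T - t) with hφ
  set D : ℝ → State F → ℝ := fun t x => -2 * (x.1.1 / N - p t) * (mu * q t) -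
    2 * (x.1.2 / N - q t) * (2 * mu * (β - p t - q t) - lam * h - mu * q t) with hD
  have hd : ∀ t z, HasDerivAt (fun t => φ t z)
      (Real.exp (-mu * t) * (D t z - mu * sqDist N (p t) (q t) z.1) - K) t := by
    intro t z
    have h1 : HasDerivAt (fun t => Real.exp (-mu * t)) (Real.exp (-mu * t) * -mu) t := by
      simpa using ((hasDerivAt_id t).const_mul (-mu)).exp
    have h2 : HasDerivAt (fun t => sqDist N (p t) (q t) z.1) (D t z) t := by
      have h3 := (((hpq.hasDerivAt_fst t).const_sub ((z.1.1 : ℝ) / N)).pow 2).add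
        (((hpq.hasDerivAt_snd t).const_sub ((z.1.2 : ℝ) / N)).pow 2)
      refine h3.congr_deriv ?_
      simp only [hD]
      push_cast
      ring
    have h4 : HasDerivAt (fun t : ℝ => K * (T - t)) (K * -1) t :=
      ((hasDerivAt_id t).const_sub (T : ℝ)).const_mul K
    refine ((h1.mul h2).add h4).congr_deriv ?_
    ring
  have hgen : ∀ t, 0 ≤ t → ∀ z, Real.exp (-mu * t) * (D t z - mu * sqDist N (p t) (q t) z.1) - K +
      (qMatrix lam mu N F).mulVec (φ t) z ≤ 0 := by
    intro t ht z
    have h1 : (qMatrix lam mu N F).mulVec (φ t) z = Real.exp (-mu * t) *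
        (qMatrix lam mu N F).mulVec (fun z => sqDist N (p t) (q t) z.1) z := by
      rw [qMatrix_mulVec, hφ,
        qMatrix_mulVec lam mu N F (fun w => Real.exp (-mu * t) * sqDist N (p t) (q t) w + K * (T - t))]
      split_ifs <;> ring
    have h2 := qMatrix_mulVec_sqDist_le hlam hmu hN (hpq.snd_nonneg t ht) hpq.nonneg hpq.le_one
      (hpq.snd_mul t) z (β := β) (p := p t)
    have h3 : Real.exp (-mu * t) ≤ 1 := by
      rw [Real.exp_le_one_iff]
      nlinarith
    have h4 := mul_le_mul_of_nonneg_left h2 (Real.exp_pos (-mu * t)).le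
    have h5 := mul_le_mul_of_nonneg_right h3 hK0
    rw [h1]
    simp only [hD]
    linear_combination h4 + h5
  have hpos : ∀ t ≤ T, ∀ z, 0 ≤ φ t z := by
    intro t ht z
    have h1 : (t : ℝ) ≤ T := by exact_mod_cast ht
    exact add_nonneg (mul_nonneg (Real.exp_pos _).le (sqDist_nonneg _ _ _ _))
      (mul_nonneg hK0 (sub_nonneg.2 h1))
  have hb' : 0 < Real.exp (-mu * T) * b := by positivity
  have hmain := hX.measure_exists_lt_le (qMatrix_nonneg hlam hmu N F) hd hgen hpos hb'
  have hint : ∫ ω, φ (0 : ℝ≥0) (X 0 ω) ∂P = sqDist N 0 0 y + K * T := by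
    have : (fun ω => φ (0 : ℝ≥0) (X 0 ω)) =ᵐ[P] fun _ => sqDist N 0 0 y + K * T := by
      filter_upwards [hX0] with ω hω
      simp [hφ, hω, hpq.fst_zero, hpq.snd_zero]
    rw [integral_congr_ae this]
    simp
  rw [NNReal.coe_zero] at hint
  rw [hint] at hmain
  refine (measure_mono ?_).trans hmain
  rintro ω ⟨t, ht, hlt⟩
  refine ⟨t, ht, ?_⟩
  have h1 : (t : ℝ) ≤ T := by exact_mod_cast ht.le
  have h2 : Real.exp (-mu * T) ≤ Real.exp (-mu * t) := by
    rw [Real.exp_le_exp]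
    nlinarith
  calc Real.exp (-mu * T) * b ≤ Real.exp (-mu * t) * b := by gcongr
    _ < Real.exp (-mu * t) * sqDist N (p t) (q t) (X t ω).1 := by gcongr
    _ ≤ φ t (X t ω) := le_add_of_nonneg_right (mul_nonneg hK0 (sub_nonneg.2 h1))

/-! ### Explicit fluid solutions and limits in `N`. -/

theorem isFluidSolution_of_le {lam mu β : ℝ} (hmu : 0 < mu) (hρ : lam / mu ≤ 2 * β) :
    IsFluidSolution lam mu β 1
      (fun t => (β - lam / mu / 2) * (1 - 2 * Real.exp (-mu * t) + Real.exp (-2 * mu * t)))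
      (fun t => (2 * β - lam / mu) * (Real.exp (-mu * t) - Real.exp (-2 * mu * t))) := by
  have h1 : ∀ t, HasDerivAt (fun t => Real.exp (-mu * t)) (Real.exp (-mu * t) * -mu) t := fun t => by
    simpa using ((hasDerivAt_id t).const_mul (-mu)).exp
  have h2 : ∀ t, HasDerivAt (fun t => Real.exp (-2 * mu * t))
      (Real.exp (-2 * mu * t) * (-2 * mu)) t := fun t => by
    simpa using ((hasDerivAt_id t).const_mul (-2 * mu)).exp
  have hlam : mu * (lam / mu) = lam := by field_simp
  refine ⟨fun t => ?_, fun t => ?_, by norm_num, by simp, fun t ht => ?_, le_rfl, zero_le_one,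
    by simp⟩
  · refine (((((h1 t).const_mul 2).const_sub 1).add (h2 t)).const_mul _).congr_deriv ?_
    ring
  · refine (((h1 t).sub (h2 t)).const_mul _).congr_deriv ?_
    linear_combination -hlam
  · refine mul_nonneg (by linarith) (sub_nonneg.2 (Real.exp_le_exp.2 ?_))
    nlinarith

/-- Here the capacity exceeds the rate `2 * mu * β` at which copies are lost; using the fraction `h`
of it balances the losses and keeps `q` at `0`. -/
theorem isFluidSolution_zero {lam mu β : ℝ} (hlam : 0 < lam) (hmu : 0 < mu) (hβ : 0 ≤ β)
    (hρ : 2 * β < lam / mu) :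
    IsFluidSolution lam mu β (2 * mu * β / lam) (fun _ => 0) (fun _ => 0) := by
  refine ⟨fun t => ?_, fun t => ?_, rfl, rfl, fun _ _ => le_rfl, ?_, by positivity, by simp⟩
  · simpa using hasDerivAt_const t (0 : ℝ)
  · refine (hasDerivAt_const t (0 : ℝ)).congr_deriv ?_
    field_simp
    ring
  · rw [lt_div_iff₀ hmu] at hρ
    rw [div_le_one hlam]
    linarith

theorem exists_isFluidSolution {lam mu β : ℝ} (hlam : 0 < lam) (hmu : 0 < mu) (hβ : 0 ≤ β) :
    ∃ h p q, IsFluidSolution lam mu β h p q ∧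
      ∀ t : ℝ≥0, (fluidLimit (lam / mu) mu β).1 t = (p t, q t) := by
  by_cases hρ : lam / mu ≤ 2 * β
  · exact ⟨_, _, _, isFluidSolution_of_le hmu hρ, fun t => by simp only [fluidLimit, if_pos hρ]⟩
  · exact ⟨_, _, _, isFluidSolution_zero hlam hmu hβ (not_le.1 hρ),
      fun t => by simp only [fluidLimit, if_neg hρ]⟩

theorem tendsto_fluidError {lam mu β : ℝ} {F : ℕ+ → ℕ}
    (hF : Tendsto (fun N : ℕ+ => (F N : ℝ) / (N : ℕ)) atTop (𝓝 β)) :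
    Tendsto (fun N : ℕ+ => fluidError lam mu β N (F N)) atTop (𝓝 0) := by
  have h0 : Tendsto (fun N : ℕ+ => (1 : ℝ) / (N : ℕ)) atTop (𝓝 0) :=
    tendsto_one_div_atTop_nhds_zero_nat.comp tendsto_PNat_val_atTop_atTop
  have := (((hF.sub_const β).pow 2).const_mul mu).add
    (((hF.const_mul (2 * mu)).add_const lam).mul h0)
  simpa [fluidError] using this

theorem tendsto_sqDist_zero (y : ℕ × ℕ) :
    Tendsto (fun N : ℕ+ => sqDist N 0 0 y) atTop (𝓝 0) := by
  have h0 : ∀ c : ℝ, Tendsto (fun N : ℕ+ => c / (N : ℕ)) atTop (𝓝 0) := fun c =>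
    (tendsto_const_div_atTop_nhds_zero_nat c).comp tendsto_PNat_val_atTop_atTop
  have := ((h0 y.1).pow 2).add ((h0 y.2).pow 2)
  simpa [sqDist] using this

theorem lt_sqDist_of_lt_dist {N : ℕ} {p q ε : ℝ} (hε : 0 ≤ ε) {z : ℕ × ℕ}
    (h : ε < dist ((z.1 : ℝ) / N, (z.2 : ℝ) / N) (p, q)) : ε ^ 2 < sqDist N p q z := by
  rw [Prod.dist_eq, lt_max_iff, Real.dist_eq, Real.dist_eq] at h
  unfold sqDist
  rcases h with h | h
  · have := pow_lt_pow_left₀ h hε two_ne_zero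
    rw [sq_abs] at this
    linarith [sq_nonneg ((z.2 : ℝ) / N - q)]
  · have := pow_lt_pow_left₀ h hε two_ne_zero
    rw [sq_abs] at this
    linarith [sq_nonneg ((z.1 : ℝ) / N - p)]

end StorageNetwork

theorem theorem1
    (lam mu β : ℝ) (hlam : 0 < lam) (hmu : 0 < mu)
    (F : ℕ+ → ℕ)
    (hF : Tendsto (fun N : ℕ+ => (F N : ℝ) / (N : ℕ)) atTop (𝓝 β))
    (y : ℕ × ℕ)
    {Ω : ℕ+ → Type*} {m : ∀ N, MeasurableSpace (Ω N)}
    (P : ∀ N, Measure (Ω N)) [∀ N, IsProbabilityMeasure (P N)]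
    (ℱ : ∀ N, Filtration ℝ≥0 (m N))
    (X : ∀ N, ℝ≥0 → Ω N → State (F N))
    (hX : ∀ N, IsMarkovJumpProcess (P N) (ℱ N) (qMatrix lam mu N (F N)) (X N))
    (hX0 : ∀ N, ∀ᵐ ω ∂(P N), (X N 0 ω).1 = y) :
    TendstoInDistribution
      (fun (N : ℕ+) (ω : Ω N) => scaledPath N (fun t => X N t ω) ((hX N).cadlag ω))
      atTop
      (fun _ : Unit => fluidLimit (lam / mu) mu β)
      P
      (Measure.dirac ()) := by
  have hβ : 0 ≤ β := ge_of_tendsto' hF fun N => by positivity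
  obtain ⟨h, p, q, hpq, hlim⟩ := exists_isFluidSolution hlam hmu hβ
  refine tendstoInDistribution_of_measure_not_skorokhodClose
    (fun N => measurable_image (g := fun z : State (F N) => ((z.1.1 : ℝ) / N, (z.1.2 : ℝ) / N))
      continuous_of_discreteTopology (hX N).cadlag (hX N).measurable) _ fun ε hε T => ?_
  -- The identity time change suffices, closeness being uniform. The horizon `T + 1` is used because
  -- the maximal bound concerns times strictly before its horizon.
  have hbound : ∀ N, P N {ω | ¬ SkorokhodClose ε T (fluidLimit (lam / mu) mu β)
      (scaledPath N (fun t => X N t ω) ((hX N).cadlag ω))} ≤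
      ENNReal.ofReal ((sqDist N 0 0 y + fluidError lam mu β N (F N) * (T + 1 : ℝ≥0)) /
        (Real.exp (-mu * (T + 1 : ℝ≥0)) * ε ^ 2)) := by
    intro N
    refine (measure_mono ?_).trans (measure_exists_lt_sqDist_le hlam.le hmu.le N.pos hpq (hX N)
      (hX0 N) (T + 1) (pow_pos hε 2))
    intro ω hω
    by_contra hcon
    refine hω ⟨OrderIso.refl _, fun t => by simpa using hε.le, fun t ht => ?_⟩
    by_contra hdist
    refine hcon ⟨t, ht.trans_lt (by simp), lt_sqDist_of_lt_dist hε.le ?_⟩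
    rw [← hlim]
    exact not_le.1 hdist
  have hzero : Tendsto (fun N : ℕ+ =>
      ENNReal.ofReal ((sqDist N 0 0 y + fluidError lam mu β N (F N) * (T + 1 : ℝ≥0)) /
        (Real.exp (-mu * (T + 1 : ℝ≥0)) * ε ^ 2))) atTop (𝓝 0) := by
    have h1 := ((tendsto_sqDist_zero y).add ((tendsto_fluidError (lam := lam) (mu := mu) hF).mul_const
      ((T + 1 : ℝ≥0) : ℝ))).div_const (Real.exp (-mu * (T + 1 : ℝ≥0)) * ε ^ 2)
    simpa using ENNReal.tendsto_ofReal h1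
  exact tendsto_of_tendsto_of_tendsto_of_le_of_le tendsto_const_nhds hzero
    (fun _ => zero_le) hbound
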